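/- For integers $d,k\ge 1$, a $k$-component Gaussian mixture density on $\mathbb{R}^d$ is a function \[ \Phi(x)=\sum_{i=1}^k \alpha_i\,\frac{1}{(2\pi)^{d/2}\det(\Sigma_i)^{1/2}}\exp\!\Bigl(-\tfrac12(x-\mu_i)^\top\Sigma_i^{-1}(x-\mu_i)\Bigr), \] where $\alpha_i>0$, $\sum_{i=1}^k\alpha_i=1$, $\mu_i\in\mathbb{R}^d$, and each $\Sigma_i$ is a (symmetric) positive definite real $d\times d$ matrix. Its modal set $\mathrm{Mode}(\Phi)$ is the set of all $x\in\mathbb{R}^d$ for which there is $r>0$ such that $\Phi(y)\le\Phi(x)$ whenever $\|y-x\|<r$. Let $m(d,k)\in\mathbb{N}\cup\{\infty\}$ be the supremum of $|\mathrm{Mode}(\Phi)|$ over all $k$-component Gaussian mixture densities $\Phi$ on $\mathbb{R}^d$ whose modal set is finite. Then for all integers $d\ge 2$ and $k\ge 2$, \[ m(d,k)\ \ge\ k+\max_{2\le r\le \min(d,k)}\binom{k}{r}. \] In particular, for all integers $k\ge 4$ and $d\ge\lfloor k/2\rfloor$, \[ m(d,k)\ \ge\ k+\binom{k}{\lfloor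 k/2\rfloor}. \] -/

import Mathlib

open scoped Matrix

noncomputable section

/-- The density at `x` of the Gaussian distribution on `ℝ^d` with mean `μ` and (positive definite)
covariance matrix `S`. -/
def gaussianDensity {d : ℕ} (μ : EuclideanSpace ℝ (Fin d)) (S : Matrix (Fin d) (Fin d) ℝ)
    (x : EuclideanSpace ℝ (Fin d)) : ℝ :=
  1 / ((2 * Real.pi) ^ ((d : ℝ) / 2) * S.det ^ ((1 : ℝ) / 2)) *
    Real.exp (-(1 / 2) * ((x - μ).ofLp ⬝ᵥ (S⁻¹ *ᵥ (x - μ).ofLp)))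

/-- The parameters of a `k`-component Gaussian mixture in `ℝ^d`: positive weights summing to `1`,
means, and positive definite covariance matrices. -/
structure GaussianMixture (d k : ℕ) where
  weight : Fin k → ℝ
  mean : Fin k → EuclideanSpace ℝ (Fin d)
  cov : Fin k → Matrix (Fin d) (Fin d) ℝ
  weight_pos : ∀ i, 0 < weight i
  sum_weight : ∑ i, weight i = 1
  cov_posDef : ∀ i, (cov i).PosDef

namespace GaussianMixture

/-- The mixture density `Φ = ∑ i, α i * φ i`. -/
def density {d k : ℕ} (G : GaussianMixture d k) (x : EuclideanSpace ℝ (Fin d)) : ℝ :=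
  ∑ i, G.weight i * gaussianDensity (G.mean i) (G.cov i) x

/-- The modal set: all (not necessarily strict) local maximum points of the density. -/
def modes {d k : ℕ} (G : GaussianMixture d k) : Set (EuclideanSpace ℝ (Fin d)) :=
  {x | ∃ r > 0, ∀ y, ‖y - x‖ < r → G.density y ≤ G.density x}

end GaussianMixture

/-- `m(d,k)`: the supremum, in `ℕ∞`, of the number of modes over all `k`-component Gaussian
mixtures in `ℝ^d` whose modal set is finite. -/
def maxModeCount (d k : ℕ) : ℕ∞ :=
  ⨆ (G : GaussianMixture d k) (_ : G.modes.Finite), G.modes.encard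

end

/-!
Each Gaussian `i` is flattened onto an affine subspace `H i` of `ℝ^d`, with the `H i` in general
position: any `r` of them meet in one point, no point lies on `r + 1` of them. In coordinates, the
points whose coordinates from `r` on vanish are the monic polynomials of degree `r`, and `H i`
consists of those having `i` as a root. The common point for `r` indices `S` is then
`∏ i ∈ S, (X - i)`, and the centre `(X - i) ^ r` of the `i`-th Gaussian lies on `H i` only.

With unnormalised Gaussians `exp (-(N T i x + ε ‖x - m i‖ ^ 2))`, where `T i` is a nonnegative
quadratic polynomial with zero set `H i`, the sum tends for `N → ∞` to the sum over those `i` with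
`x ∈ H i`. For small `ε` this is nearly `r` at a common point of `r` of the `H i`, and at most
`r - 1` elsewhere nearby; at a centre it is `1`, and less than `1` on a small sphere around it.
By compactness (`eventually_sum_exp_lt_of_isCompact`), for large `N` the sum has strict maxima over small disjoint
spheres around all `k + C(k,r)` points (`card_le_maxModeCount_of_arrangement`).

The modal set must also be finite. Multiplying the sum by `exp ⟪l, x⟫` yields again a positive
multiple of a mixture density (`exists_density_eq`), and small `l` preserve the strict maxima over
the spheres. The critical points of the tilted sum are the solutions of `F x = -l`, where `F` is the
gradient of the logarithm of the sum. By Sard's theorem `-l` is a regular value of `F` for almost all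
`l`; then the solutions are isolated, and they form a compact set because the quadratic forms are
coercive. So they are finite in number (`ae_finite_logGradient_eq`, `exists_tilt`).
-/

open Filter Topology MeasureTheory

/-! ### Tilted sums of Gaussians and their critical points -/

section LogGradient

variable {E : Type*} [NormedAddCommGroup E] [InnerProductSpace ℝ E]

/-- The unnormalised Gaussian `exp (-⟪x - m, B (x - m)⟫ / 2)` with centre `m` and precision
operator `B`. -/
noncomputable def bump (B : E →L[ℝ] E) (m x : E) : ℝ :=
  Real.exp (-(1 / 2) * inner ℝ (x - m) (B (x - m)))

/-- A finite sum of unnormalised Gaussians. -/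
noncomputable def bumpSum {ι : Type*} [Fintype ι] (B : ι → E →L[ℝ] E) (m : ι → E) (x : E) : ℝ :=
  ∑ i, bump (B i) (m i) x

/-- The gradient of `log (bumpSum B m)`, given by its explicit formula; it is the gradient when the
operators `B i` are symmetric. -/
noncomputable def logGradient {ι : Type*} [Fintype ι] (B : ι → E →L[ℝ] E) (m : ι → E) (x : E) : E :=
  (bumpSum B m x)⁻¹ • ∑ i, bump (B i) (m i) x • B i (m i - x)

lemma bump_pos (B : E →L[ℝ] E) (m x : E) : 0 < bump B m x := Real.exp_pos _

lemma contDiff_bump (B : E →L[ℝ] E) (m : E) {n : WithTop ℕ∞} : ContDiff ℝ n (bump B m) := by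
  unfold bump
  exact Real.contDiff_exp.comp (contDiff_const.mul ((contDiff_id.sub contDiff_const).inner ℝ
    (B.contDiff.comp (contDiff_id.sub contDiff_const))))

lemma hasFDerivAt_bump {B : E →L[ℝ] E} (hB : ∀ x y, inner ℝ (B x) y = inner ℝ x (B y)) (m x : E) :
    HasFDerivAt (bump B m) (innerSL ℝ (bump B m x • B (m - x))) x := by
  have h1 : HasFDerivAt (fun y : E => y - m) (ContinuousLinearMap.id ℝ E) x :=
    (hasFDerivAt_id x).sub_const m
  have h2 : HasFDerivAt (fun y : E => B (y - m)) (B.comp (ContinuousLinearMap.id ℝ E)) x :=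
    B.hasFDerivAt.comp x h1
  have h3 := ((h1.inner ℝ h2).const_mul (-(1 / 2 : ℝ))).exp
  refine h3.congr_fderiv ?_
  ext v
  have h4 : inner ℝ v (B (x - m)) = inner ℝ (B (x - m)) v := real_inner_comm _ _
  have h5 : inner ℝ (x - m) (B v) = inner ℝ (B (x - m)) v := (hB _ _).symm
  have h6 : B (m - x) = - B (x - m) := by rw [← map_neg, neg_sub]
  simp only [bump, smul_apply, ContinuousLinearMap.comp_apply,
    ContinuousLinearMap.prod_apply, ContinuousLinearMap.id_apply, fderivInnerCLM_apply,
    innerSL_apply_apply, h4, h5, h6, inner_smul_left, inner_neg_left, smul_eq_mul,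
    RCLike.conj_to_real]
  ring

variable {ι : Type*} [Fintype ι] {B : ι → E →L[ℝ] E} {m : ι → E}

lemma bumpSum_pos [Nonempty ι] (B : ι → E →L[ℝ] E) (m : ι → E) (x : E) : 0 < bumpSum B m x :=
  Finset.sum_pos (fun i _ => bump_pos (B i) (m i) x) Finset.univ_nonempty

lemma contDiff_bumpSum (B : ι → E →L[ℝ] E) (m : ι → E) {n : WithTop ℕ∞} :
    ContDiff ℝ n (bumpSum B m) := by
  unfold bumpSum
  exact ContDiff.sum fun i _ => contDiff_bump (B i) (m i)

lemma contDiff_logGradient [Nonempty ι] (B : ι → E →L[ℝ] E) (m : ι → E) {n : WithTop ℕ∞} :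
    ContDiff ℝ n (logGradient B m) := by
  unfold logGradient
  refine ((contDiff_bumpSum B m).inv fun x => (bumpSum_pos B m x).ne').smul ?_
  exact ContDiff.sum fun i _ => (contDiff_bump (B i) (m i)).smul
    ((B i).contDiff.comp (contDiff_const.sub contDiff_id))

/-- The local maxima of the sum tilted by `exp ⟪l, ·⟫` lie in a level set of `logGradient`. -/
lemma logGradient_eq_neg_of_isLocalMax [Nonempty ι]
    (hB : ∀ i x y, inner ℝ (B i x) y = inner ℝ x (B i y)) {l x : E}
    (hx : IsLocalMax (fun y => Real.exp (inner ℝ l y) * bumpSum B m y) x) :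
    logGradient B m x = -l := by
  have h1 : HasFDerivAt (bumpSum B m)
      (∑ i, innerSL ℝ (bump (B i) (m i) x • B i (m i - x))) x := by
    unfold bumpSum
    exact HasFDerivAt.fun_sum fun i _ => hasFDerivAt_bump (hB i) (m i) x
  have h2 : HasFDerivAt (fun y : E => inner ℝ l y) (innerSL ℝ l) x := (innerSL ℝ l).hasFDerivAt
  have h3 := hx.hasFDerivAt_eq_zero (h2.exp.mul h1)
  have h4 : (∑ i, bump (B i) (m i) x • B i (m i - x)) + bumpSum B m x • l = 0 := by
    refine ext_inner_right ℝ fun v => ?_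
    have h5 := congrArg (fun f : E →L[ℝ] ℝ => f v) h3
    simp only [add_apply, smul_apply,
      sum_apply, innerSL_apply_apply, smul_eq_mul,
      zero_apply] at h5
    rw [inner_add_left, sum_inner, inner_smul_left, inner_zero_left, RCLike.conj_to_real]
    have h6 := (Real.exp_pos (inner ℝ l x)).ne'
    refine mul_left_cancel₀ h6 ?_
    rw [mul_zero, ← h5]
    ring
  rw [logGradient, eq_neg_of_add_eq_zero_left h4, smul_neg, smul_smul,
    inv_mul_cancel₀ (bumpSum_pos B m x).ne', one_smul]

lemma isBounded_logGradient_eq [Nonempty ι] {c : ℝ} (hc : 0 < c)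
    (hBc : ∀ i x, c * ‖x‖ ^ 2 ≤ inner ℝ x (B i x)) (l : E) :
    Bornology.IsBounded {x | logGradient B m x = l} := by
  refine (Metric.isBounded_closedBall (x := (0 : E))
    (r := (∑ i, ‖B i (m i)‖ + ‖l‖) / c)).subset fun x (hx : logGradient B m x = l) => ?_
  rw [mem_closedBall_zero_iff]
  by_contra! hR
  rw [div_lt_iff₀ hc] at hR
  have hx0 : 0 < ‖x‖ := by
    by_contra! h
    have : 0 ≤ ∑ i, ‖B i (m i)‖ + ‖l‖ := by positivity
    nlinarith
  have h1 : ∑ i, bump (B i) (m i) x * inner ℝ x (B i (m i - x) - l) = 0 := by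
    have h2 : ∑ i, bump (B i) (m i) x • B i (m i - x) = bumpSum B m x • l := by
      rw [← hx, logGradient, smul_smul, mul_inv_cancel₀ (bumpSum_pos B m x).ne', one_smul]
    have h3 : ∑ i, bump (B i) (m i) x • (B i (m i - x) - l) = 0 := by
      simp only [smul_sub, Finset.sum_sub_distrib, h2, bumpSum, Finset.sum_smul, sub_self]
    simpa [inner_sum, inner_smul_right] using congrArg (inner ℝ x) h3
  refine h1.not_lt (Finset.sum_neg (fun i _ => mul_neg_of_pos_of_neg (bump_pos _ _ _) ?_)
    Finset.univ_nonempty)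
  have h4 := real_inner_le_norm x (B i (m i))
  have h5 := neg_le_of_abs_le (abs_real_inner_le_norm x l)
  have h6 : ‖B i (m i)‖ ≤ ∑ i, ‖B i (m i)‖ :=
    Finset.single_le_sum (f := fun i => ‖B i (m i)‖) (fun _ _ => norm_nonneg _) (Finset.mem_univ i)
  have h7 := hBc i x
  rw [map_sub, inner_sub_right, inner_sub_right]
  nlinarith

/-- By Sard's theorem almost every `l` is a regular value of `logGradient`; its level sets at
regular values are discrete, and they are compact by coercivity. -/
lemma ae_finite_logGradient_eq [FiniteDimensional ℝ E] [MeasurableSpace E] [BorelSpace E]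
    (μ : Measure E) [μ.IsAddHaarMeasure] [Nonempty ι] {c : ℝ} (hc : 0 < c)
    (hBc : ∀ i x, c * ‖x‖ ^ 2 ≤ inner ℝ x (B i x)) :
    ∀ᵐ l ∂μ, {x | logGradient B m x = l}.Finite := by
  set F := logGradient B m with hF
  have hFd : ContDiff ℝ 1 F := contDiff_logGradient B m
  have hd : Differentiable ℝ F := hFd.differentiable one_ne_zero
  have hsard : μ (F '' {x | (fderiv ℝ F x).det = 0}) = 0 :=
    addHaar_image_eq_zero_of_det_fderivWithin_eq_zero μ
      (fun x _ => (hd x).hasFDerivAt.hasFDerivWithinAt) fun x hx => hx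
  filter_upwards [measure_eq_zero_iff_ae_notMem.1 hsard] with l hl
  by_contra hinf
  have hcl : IsClosed {x | F x = l} := isClosed_eq hFd.continuous continuous_const
  have hK : IsCompact {x | F x = l} :=
    Metric.isCompact_of_isClosed_isBounded hcl (isBounded_logGradient_eq hc hBc l)
  obtain ⟨x, hx, hacc⟩ := Set.Infinite.exists_accPt_of_subset_isCompact hinf hK subset_rfl
  have hdet : (fderiv ℝ F x).det ≠ 0 := fun h => hl ⟨x, h, hx⟩
  set e := (fderiv ℝ F x).toContinuousLinearEquivOfDetNeZero hdet with he
  have hanti : ∃ C, AntilipschitzWith C (fderiv ℝ F x) := ⟨_, e.antilipschitz⟩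
  have hne := (hd x).hasFDerivAt.eventually_ne (c := l) hanti
  rw [accPt_iff_frequently_nhdsNE] at hacc
  exact hacc (hne.mono fun z hz h => hz h)

/-- A strict maximum over a sphere persists under a small tilt. -/
lemma eventually_tilt_lt_of_sphere [FiniteDimensional ℝ E] {f : E → ℝ} (hf : Continuous f) {p : E}
    {ρ : ℝ} (hp : ∀ y ∈ Metric.sphere p ρ, f y < f p) :
    ∀ᶠ l in 𝓝 (0 : E), ∀ y ∈ Metric.sphere p ρ,
      Real.exp (inner ℝ l y) * f y < Real.exp (inner ℝ l p) * f p := by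
  refine (isCompact_sphere p ρ).eventually_forall_of_forall_eventually fun y hy => ?_
  have h1 : Continuous fun z : E × E => Real.exp (inner ℝ z.1 z.2) * f z.2 := by fun_prop
  have h2 : Continuous fun z : E × E => Real.exp (inner ℝ z.1 p) * f p := by fun_prop
  exact h1.continuousAt.eventually_lt h2.continuousAt (by simpa using hp y hy)

/-- Some small tilt keeps the strict maxima over the given spheres and has finitely many local
maxima: small tilts are all good for the former, almost all tilts for the latter. -/
lemma exists_tilt [FiniteDimensional ℝ E] [Nonempty ι]
    (hB : ∀ i x y, inner ℝ (B i x) y = inner ℝ x (B i y)) {c : ℝ} (hc : 0 < c)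
    (hBc : ∀ i x, c * ‖x‖ ^ 2 ≤ inner ℝ x (B i x)) {J : Type*} [Finite J] (p : J → E) {ρ : ℝ}
    (hρ : 0 < ρ) (hp : ∀ j, ∀ y ∈ Metric.sphere (p j) ρ, bumpSum B m y < bumpSum B m (p j)) :
    ∃ l : E, {x | IsLocalMax (fun y => Real.exp (inner ℝ l y) * bumpSum B m y) x}.Finite ∧
      ∀ j, ∃ x ∈ Metric.ball (p j) ρ,
        IsLocalMax (fun y => Real.exp (inner ℝ l y) * bumpSum B m y) x := by
  let _ : MeasurableSpace E := borel E
  have _ : BorelSpace E := ⟨rfl⟩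
  have hcont : Continuous (bumpSum B m) := (contDiff_bumpSum B m (n := 0)).continuous
  have hfin : ∀ᵐ l ∂(Measure.addHaar : Measure E), {x | logGradient B m x = l}.Finite :=
    ae_finite_logGradient_eq _ hc hBc
  have hdense : Dense {l : E | {x | logGradient B m x = l}.Finite} := Measure.dense_of_ae hfin
  have hneg : Tendsto (fun l : E => -l) (𝓝 0) (𝓝 0) := by simpa using tendsto_neg (0 : E)
  have hsph := eventually_all.2 fun j => eventually_tilt_lt_of_sphere hcont (hp j)
  obtain ⟨l, hl, hls⟩ :=
    ((mem_closure_iff_frequently.1 (hdense 0)).and_eventually (hneg.eventually hsph)).exists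
  refine ⟨-l, Set.Finite.subset hl fun x hx => ?_, fun j => ?_⟩
  · have h := logGradient_eq_neg_of_isLocalMax hB hx
    rwa [neg_neg] at h
  · refine (isCompact_closedBall (p j) ρ).exists_isLocalMax_mem_open Metric.ball_subset_closedBall
      (Continuous.continuousOn (by fun_prop)) (Metric.mem_closedBall_self hρ.le) (fun z hz => ?_)
      Metric.isOpen_ball
    rw [Metric.closedBall_sdiff_ball] at hz
    exact hls j z hz

end LogGradient

/-! ### Realization by mixtures -/

section Realization

lemma inner_toEuclideanCLM_left {d : ℕ} {A : Matrix (Fin d) (Fin d) ℝ} (hA : A.IsHermitian)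
    (x y : EuclideanSpace ℝ (Fin d)) :
    inner ℝ (Matrix.toEuclideanCLM (𝕜 := ℝ) A x) y =
      inner ℝ x (Matrix.toEuclideanCLM (𝕜 := ℝ) A y) := by
  have hT : Aᵀ = A := by
    rw [← Matrix.conjTranspose_eq_transpose_of_trivial]
    exact hA
  rw [real_inner_comm, Matrix.inner_toEuclideanCLM, Matrix.inner_toEuclideanCLM,
    Matrix.dotProduct_mulVec, ← Matrix.mulVec_transpose, dotProduct_comm, hT]

/-- Completing the square: a tilted Gaussian is a positive multiple of a Gaussian density with the
inverse of the precision matrix as covariance. -/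
lemma exists_exp_inner_mul_bump_eq {d : ℕ} {A : Matrix (Fin d) (Fin d) ℝ} (hA : A.PosDef)
    (m l : EuclideanSpace ℝ (Fin d)) :
    ∃ w > 0, ∃ μ, ∀ x, Real.exp (inner ℝ l x) * bump (Matrix.toEuclideanCLM (𝕜 := ℝ) A) m x =
      w * gaussianDensity μ A⁻¹ x := by
  have hdet : IsUnit A.det := (Matrix.isUnit_iff_isUnit_det A).1 hA.isUnit
  set B := Matrix.toEuclideanCLM (𝕜 := ℝ) A
  set u := Matrix.toEuclideanCLM (𝕜 := ℝ) A⁻¹ l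
  have hu : B u = l := by
    have h : B * Matrix.toEuclideanCLM (𝕜 := ℝ) A⁻¹ = 1 := by
      rw [← map_mul, Matrix.mul_nonsing_inv A hdet, map_one]
    exact congrArg (fun f : EuclideanSpace ℝ (Fin d) →L[ℝ] EuclideanSpace ℝ (Fin d) => f l) h
  have hK : 0 < (2 * Real.pi) ^ ((d : ℝ) / 2) * (A⁻¹).det ^ ((1 : ℝ) / 2) :=
    mul_pos (Real.rpow_pos_of_pos (by positivity) _) (Real.rpow_pos_of_pos hA.inv.det_pos _)
  -- The centre moves by `u = A⁻¹ l`; `w` collects the normalising constant and the terms free of `x`.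
  refine ⟨((2 * Real.pi) ^ ((d : ℝ) / 2) * (A⁻¹).det ^ ((1 : ℝ) / 2)) *
    Real.exp (inner ℝ l m + 1 / 2 * inner ℝ u l), mul_pos hK (Real.exp_pos _), m + u, fun x => ?_⟩
  rw [gaussianDensity, Matrix.nonsing_inv_nonsing_inv A hdet, bump]
  have h1 : inner ℝ (x - (m + u)) (B (x - (m + u))) =
      (x - (m + u)).ofLp ⬝ᵥ (A *ᵥ (x - (m + u)).ofLp) := Matrix.inner_toEuclideanCLM _ _ _
  rw [← h1]
  have h2 : inner ℝ (x - (m + u)) (B (x - (m + u))) =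
      inner ℝ (x - m) (B (x - m)) - 2 * inner ℝ l (x - m) + inner ℝ u l := by
    rw [← sub_sub, map_sub, hu, inner_sub_left, inner_sub_right, inner_sub_right,
      ← inner_toEuclideanCLM_left hA.isHermitian u, hu, real_inner_comm (x - m) l]
    ring
  have h3 : inner ℝ l (x - m) = inner ℝ l x - inner ℝ l m := inner_sub_right _ _ _
  have h4 : ∀ K a b : ℝ, K ≠ 0 → K * Real.exp a * (1 / K * Real.exp b) = Real.exp (a + b) := by
    intro K a b hK
    rw [Real.exp_add]
    field_simp
  rw [h4 _ _ _ hK.ne', ← Real.exp_add, h2, h3]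
  congr 1
  ring

/-- A tilted sum of unnormalised Gaussians is a positive multiple of a mixture density. -/
lemma exists_density_eq {d k : ℕ} [NeZero k] {A : Fin k → Matrix (Fin d) (Fin d) ℝ}
    (hA : ∀ i, (A i).PosDef) (m : Fin k → EuclideanSpace ℝ (Fin d))
    (l : EuclideanSpace ℝ (Fin d)) :
    ∃ G : GaussianMixture d k, ∃ c > 0, ∀ x, G.density x = c * (Real.exp (inner ℝ l x) *
      bumpSum (fun i => Matrix.toEuclideanCLM (𝕜 := ℝ) (A i)) m x) := by
  choose w hw μ hμ using fun i => exists_exp_inner_mul_bump_eq (hA i) (m i) l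
  have hW : 0 < ∑ i, w i := Finset.sum_pos (fun i _ => hw i) Finset.univ_nonempty
  refine ⟨⟨fun i => (∑ i, w i)⁻¹ * w i, μ, fun i => (A i)⁻¹,
    fun i => mul_pos (inv_pos.2 hW) (hw i), ?_, fun i => (hA i).inv⟩, (∑ i, w i)⁻¹, inv_pos.2 hW,
    fun x => ?_⟩
  · rw [← Finset.mul_sum, inv_mul_cancel₀ hW.ne']
  · simp only [GaussianMixture.density, bumpSum, Finset.mul_sum, hμ, mul_assoc]

lemma GaussianMixture.modes_eq {d k : ℕ} (G : GaussianMixture d k) :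
    G.modes = {x | IsLocalMax G.density x} := by
  ext x
  simp only [GaussianMixture.modes, IsLocalMax, IsMaxFilter, Metric.eventually_nhds_iff,
    Set.mem_ofPred_eq, dist_eq_norm]

/-- Strict maxima of a sum of unnormalised Gaussians over disjoint balls all yield modes of one
mixture with a finite modal set. -/
lemma card_le_maxModeCount_of_peaks {d k : ℕ} [NeZero k] {A : Fin k → Matrix (Fin d) (Fin d) ℝ}
    (hA : ∀ i, (A i).PosDef) {c : ℝ} (hc : 0 < c)
    (hAc : ∀ i x, c * ‖x‖ ^ 2 ≤ inner ℝ x (Matrix.toEuclideanCLM (𝕜 := ℝ) (A i) x))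
    (m : Fin k → EuclideanSpace ℝ (Fin d)) {J : Type*} [Fintype J]
    (p : J → EuclideanSpace ℝ (Fin d)) {ρ : ℝ} (hρ : 0 < ρ)
    (hdisj : Pairwise fun a b => 2 * ρ ≤ dist (p a) (p b))
    (hp : ∀ j, ∀ y ∈ Metric.sphere (p j) ρ,
      bumpSum (fun i => Matrix.toEuclideanCLM (𝕜 := ℝ) (A i)) m y <
        bumpSum (fun i => Matrix.toEuclideanCLM (𝕜 := ℝ) (A i)) m (p j)) :
    (Fintype.card J : ℕ∞) ≤ maxModeCount d k := by
  obtain ⟨l, hfin, hmax⟩ := exists_tilt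
    (fun i => inner_toEuclideanCLM_left (hA i).isHermitian) hc hAc p hρ hp
  obtain ⟨G, s, hs, hG⟩ := exists_density_eq hA m l
  have hmodes : G.modes = {x | IsLocalMax (fun y => Real.exp (inner ℝ l y) *
      bumpSum (fun i => Matrix.toEuclideanCLM (𝕜 := ℝ) (A i)) m y) x} := by
    rw [G.modes_eq]
    ext x
    simp only [IsLocalMax, IsMaxFilter, Set.mem_ofPred_eq, hG, mul_le_mul_iff_right₀ hs]
  rw [← hmodes] at hfin
  choose x hx hxmax using hmax
  have hinj : Function.Injective x := by
    intro a b hab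
    by_contra hne
    have h1 := Metric.mem_ball'.1 (hx a)
    have h2 := Metric.mem_ball.1 (hx b)
    rw [← hab] at h2
    have h3 := hdisj hne
    have h4 := dist_triangle (p a) (x a) (p b)
    linarith
  have hsub : Set.range x ⊆ G.modes := by
    rw [hmodes]
    rintro _ ⟨j, rfl⟩
    exact hxmax j
  calc (Fintype.card J : ℕ∞) = (Set.range x).encard := by
        rw [← Set.image_univ, hinj.encard_image, Set.encard_univ, ENat.card_eq_coe_fintype_card]
    _ ≤ G.modes.encard := Set.encard_le_encard hsub
    _ ≤ maxModeCount d k := le_iSup₂_of_le (f := fun (G : GaussianMixture d k)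
        (_ : G.modes.Finite) => G.modes.encard) G hfin le_rfl

end Realization

/-! ### Peaks at the intersections of concentrated Gaussians -/

section Peaks

/-- The value at `x` of the quadratic form of `M` centred at `m`. -/
noncomputable def centredForm {d : ℕ} (M : Matrix (Fin d) (Fin d) ℝ)
    (m x : EuclideanSpace ℝ (Fin d)) : ℝ :=
  (x - m).ofLp ⬝ᵥ (M *ᵥ (x - m).ofLp)

lemma continuous_centredForm {d : ℕ} (M : Matrix (Fin d) (Fin d) ℝ)
    (m : EuclideanSpace ℝ (Fin d)) : Continuous (centredForm M m) := by
  have h : centredForm M m =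
      fun x => inner ℝ (x - m) (Matrix.toEuclideanCLM (𝕜 := ℝ) M (x - m)) := by
    ext x
    rw [Matrix.inner_toEuclideanCLM, centredForm]
  rw [h]
  fun_prop

lemma centredForm_nonneg {d : ℕ} {M : Matrix (Fin d) (Fin d) ℝ} (hM : M.PosSemidef)
    (m x : EuclideanSpace ℝ (Fin d)) : 0 ≤ centredForm M m x := by
  simpa [centredForm] using hM.dotProduct_mulVec_nonneg (x - m).ofLp

/-- A bound on the terms that do not decay, required on each point of a compact set, bounds the
whole sum uniformly once the concentration parameter `N` is large. -/
lemma eventually_sum_exp_lt_of_isCompact {X ι : Type*} [TopologicalSpace X] [Fintype ι] {K : Set X}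
    (hK : IsCompact K) {T D : ι → X → ℝ} (hT : ∀ i, Continuous (T i)) (hD : ∀ i, Continuous (D i))
    (hT0 : ∀ i x, 0 ≤ T i x) (hD0 : ∀ i x, 0 ≤ D i x) [∀ x, DecidablePred fun i => T i x = 0]
    {L : ℝ} (hL : ∀ y ∈ K, ∑ i with T i y = 0, Real.exp (-D i y) < L) :
    ∀ᶠ N : ℝ in atTop, ∀ y ∈ K, ∑ i, Real.exp (-(N * T i y + D i y)) < L := by
  have key : ∀ y ∈ K, ∀ᶠ z : ℝ × X in atTop ×ˢ 𝓝 y,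
      ∑ i, Real.exp (-(z.1 * T i z.2 + D i z.2)) < L := by
    intro y hy
    have hlim : Tendsto (fun z : ℝ × X => ∑ i, if T i y = 0 then Real.exp (-D i z.2)
        else Real.exp (-(z.1 * T i z.2))) (atTop ×ˢ 𝓝 y)
        (𝓝 (∑ i, if T i y = 0 then Real.exp (-D i y) else 0)) := by
      refine tendsto_finsetSum _ fun i _ => ?_
      split_ifs with hi
      · exact ((Real.continuous_exp.comp (hD i).neg).tendsto y).comp tendsto_snd
      · exact Real.tendsto_exp_neg_atTop_nhds_zero.comp (tendsto_fst.atTop_mul_pos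
          ((hT0 i y).lt_of_ne' hi) (((hT i).tendsto y).comp tendsto_snd))
    rw [← Finset.sum_filter] at hlim
    filter_upwards [hlim.eventually_lt_const (hL y hy),
      tendsto_fst.eventually (eventually_ge_atTop (0 : ℝ))] with z hz hz0
    refine lt_of_le_of_lt (Finset.sum_le_sum fun i _ => ?_) hz
    have h1 := mul_nonneg hz0 (hT0 i z.2)
    have h2 := hD0 i z.2
    split_ifs
    · exact Real.exp_le_exp.2 (by linarith)
    · exact Real.exp_le_exp.2 (by linarith)
  have h : ∀ᶠ z : ℝ × X in atTop ×ˢ 𝓝ˢ K, ∑ i, Real.exp (-(z.1 * T i z.2 + D i z.2)) < L :=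
    hK.mem_prod_nhdsSet_of_forall key
  exact h.curry.mono fun N hN y hy => (hN.self_of_nhdsSet) y hy

/-- With precision matrix `2 N M + 2 ε I` a Gaussian concentrates on `m + ker M` as `N` grows, and
decays slowly along it for small `ε`. -/
lemma bump_toEuclideanCLM_eq {d : ℕ} (M : Matrix (Fin d) (Fin d) ℝ) (N ε : ℝ)
    (m x : EuclideanSpace ℝ (Fin d)) :
    bump (Matrix.toEuclideanCLM (𝕜 := ℝ) ((2 * N) • M + (2 * ε) • 1)) m x =
      Real.exp (-(N * centredForm M m x + ε * ‖x - m‖ ^ 2)) := by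
  rw [bump, Matrix.inner_toEuclideanCLM, centredForm, ← real_inner_self_eq_norm_sq,
    EuclideanSpace.inner_eq_star_dotProduct, Matrix.add_mulVec, Matrix.smul_mulVec,
    Matrix.smul_mulVec, Matrix.one_mulVec, dotProduct_add, dotProduct_smul, dotProduct_smul]
  simp only [star_trivial, smul_eq_mul]
  congr 1
  ring

/-- Let the zero sets `H i` of positive semidefinite forms centred at `m i` be such that `m i` lies
on `H i` only, and such that the `H i` with `i ∈ S` have a single common point, which lies on no
other `H i`, for every `S ∈ 𝒮`. Then some mixture of `k` Gaussians has modes near all `m i` and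
near all these common points. -/
theorem card_le_maxModeCount_of_arrangement {d k : ℕ} [NeZero k]
    {M : Fin k → Matrix (Fin d) (Fin d) ℝ} (hM : ∀ i, (M i).PosSemidef)
    {m : Fin k → EuclideanSpace ℝ (Fin d)}
    (hm : ∀ i j, centredForm (M i) (m i) (m j) = 0 ↔ i = j)
    (𝒮 : Finset (Finset (Fin k))) {p : Finset (Fin k) → EuclideanSpace ℝ (Fin d)}
    (h𝒮 : ∀ S ∈ 𝒮, 2 ≤ S.card)
    (hp : ∀ S ∈ 𝒮, ∀ i, centredForm (M i) (m i) (p S) = 0 ↔ i ∈ S)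
    (huniq : ∀ S ∈ 𝒮, ∀ y, (∀ i ∈ S, centredForm (M i) (m i) y = 0) → y = p S) :
    ((k + 𝒮.card : ℕ) : ℕ∞) ≤ maxModeCount d k := by
  classical
  set T : Fin k → EuclideanSpace ℝ (Fin d) → ℝ := fun i => centredForm (M i) (m i) with hTdef
  have hTc : ∀ i, Continuous (T i) := fun i => continuous_centredForm (M i) (m i)
  have hT0 : ∀ i x, 0 ≤ T i x := fun i x => centredForm_nonneg (hM i) (m i) x
  set q : Fin k ⊕ 𝒮 → EuclideanSpace ℝ (Fin d) := Sum.elim m fun S => p S with hq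
  have hZm : ∀ i, (Finset.univ.filter fun j => T j (m i) = 0) = {i} := by
    intro i
    ext j
    simp [hTdef, hm]
  have hZp : ∀ S : 𝒮, (Finset.univ.filter fun j => T j (p S) = 0) = S := by
    intro S
    ext j
    simp [hTdef, hp S S.2]
  have hqinj : Function.Injective q := by
    -- The set of `i` with `T i = 0` recovers the index of a point.
    have hcard : ∀ i, ∀ S : 𝒮, {i} ≠ S.1 := fun i S h => by
      have h2 := h𝒮 S S.2
      rw [← h, Finset.card_singleton] at h2
      omega
    intro a b h
    have hZ : (Finset.univ.filter fun l => T l (q a) = 0) =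
        Finset.univ.filter fun l => T l (q b) = 0 := by rw [h]
    rcases a with i | S <;> rcases b with j | S' <;>
      simp only [hq, Sum.elim_inl, Sum.elim_inr, hZm, hZp] at hZ
    · rw [Finset.singleton_injective hZ]
    · exact absurd hZ (hcard i S')
    · exact absurd hZ.symm (hcard j S)
    · rw [Subtype.ext hZ]
  obtain ⟨ρ, hρ, hdisj, hZρ⟩ : ∃ ρ > 0, (∀ a b, a ≠ b → 2 * ρ ≤ dist (q a) (q b)) ∧
      ∀ a, ∀ y ∈ Metric.sphere (q a) ρ, ∀ i, T i y = 0 → T i (q a) = 0 := by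
    have h1 : ∀ a b, ∀ᶠ ρ in 𝓝[>] (0 : ℝ), a ≠ b → 2 * ρ ≤ dist (q a) (q b) := by
      intro a b
      by_cases hab : a = b
      · simp [hab]
      · have h : Tendsto (fun ρ : ℝ => 2 * ρ) (𝓝[>] 0) (𝓝 (2 * 0)) :=
          ((continuous_const.mul continuous_id).tendsto _).mono_left nhdsWithin_le_nhds
        rw [mul_zero] at h
        filter_upwards [h.eventually_lt_const (dist_pos.2 fun e => hab (hqinj e))] with ρ hρ _
        exact hρ.le
    have h2 : ∀ a, ∀ᶠ ρ in 𝓝[>] (0 : ℝ), ∀ y ∈ Metric.sphere (q a) ρ,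
        ∀ i, T i y = 0 → T i (q a) = 0 := by
      intro a
      have h3 : ∀ᶠ y in 𝓝 (q a), ∀ i, T i y = 0 → T i (q a) = 0 := by
        refine eventually_all.2 fun i => ?_
        by_cases hi : T i (q a) = 0
        · simp [hi]
        · filter_upwards [(hTc i).continuousAt.eventually_ne hi] with y hy h
          exact absurd h hy
      obtain ⟨R, hR, hball⟩ := Metric.eventually_nhds_iff.1 h3
      filter_upwards [Ioo_mem_nhdsGT hR] with ρ hρ y hy
      exact hball (by rw [Metric.mem_sphere.1 hy]; exact hρ.2)
    obtain ⟨ρ, h3, h4, h5⟩ := ((eventually_all.2 fun a => eventually_all.2 (h1 a)).and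
      ((eventually_all.2 h2).and self_mem_nhdsWithin)).exists
    exact ⟨ρ, h5, h3, h4⟩
  -- As `N → ∞` the sum tends pointwise to the part supported on the zero sets, which peaks at
  -- `q a` over the sphere if `ε` is small.
  obtain ⟨ε, hε, hcore⟩ : ∃ ε > 0, ∀ a, ∀ y ∈ Metric.sphere (q a) ρ,
      ∑ i with T i y = 0, Real.exp (-(ε * ‖y - m i‖ ^ 2)) <
        ∑ i with T i (q a) = 0, Real.exp (-(ε * ‖q a - m i‖ ^ 2)) := by
    -- Near `m i` only the `i`-th term counts and it is maximal at its centre. At `p S` the sum is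
    -- close to `S.card`, while on the sphere at least one of the terms is lost.
    have h1 : ∀ a, ∀ᶠ ε in 𝓝[>] (0 : ℝ), ∀ y ∈ Metric.sphere (q a) ρ,
        ∑ i with T i y = 0, Real.exp (-(ε * ‖y - m i‖ ^ 2)) <
          ∑ i with T i (q a) = 0, Real.exp (-(ε * ‖q a - m i‖ ^ 2)) := by
      rintro (i | S)
      · filter_upwards [self_mem_nhdsWithin] with ε (hε : 0 < ε) y hy
        have hsub : (Finset.univ.filter fun j => T j y = 0) ⊆ {i} := by
          rw [← hZm i]
          intro j hj
          rw [Finset.mem_filter] at hj ⊢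
          exact ⟨hj.1, hZρ (Sum.inl i) y hy j hj.2⟩
        have hy' : ‖y - m i‖ = ρ := mem_sphere_iff_norm.1 hy
        calc ∑ j with T j y = 0, Real.exp (-(ε * ‖y - m j‖ ^ 2))
            ≤ ∑ j ∈ {i}, Real.exp (-(ε * ‖y - m j‖ ^ 2)) :=
              Finset.sum_le_sum_of_subset_of_nonneg hsub fun _ _ _ => (Real.exp_pos _).le
          _ < 1 := by
              rw [Finset.sum_singleton, hy', Real.exp_lt_one_iff]
              have := mul_pos hε (pow_pos hρ 2)
              linarith
          _ = ∑ j with T j (q (Sum.inl i)) = 0, Real.exp (-(ε * ‖q (Sum.inl i) - m j‖ ^ 2)) := by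
              simp only [hq, Sum.elim_inl, hZm, Finset.sum_singleton]
              simp
      · have hlim : Tendsto (fun ε : ℝ => ∑ i ∈ S.1, Real.exp (-(ε * ‖p S - m i‖ ^ 2))) (𝓝[>] 0)
            (𝓝 (∑ i ∈ S.1, Real.exp (-(0 * ‖p S - m i‖ ^ 2)))) :=
          (Continuous.tendsto (by fun_prop) _).mono_left nhdsWithin_le_nhds
        have hlt : ((S.1.card : ℝ) - 1) < ∑ i ∈ S.1, Real.exp (-(0 * ‖p S - m i‖ ^ 2)) := by
          simp
        filter_upwards [hlim.eventually_const_lt hlt, self_mem_nhdsWithin]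
          with ε h2 (hε : 0 < ε) y hy
        have hss : (Finset.univ.filter fun j => T j y = 0) ⊂ S.1 := by
          refine Finset.ssubset_iff_subset_ne.2 ⟨?_, fun h => ?_⟩
          · intro j hj
            rw [← hZp S]
            rw [Finset.mem_filter] at hj ⊢
            exact ⟨hj.1, hZρ (Sum.inr S) y hy j hj.2⟩
          · have hy' := huniq S S.2 y fun i hi => by
              rw [← h, Finset.mem_filter] at hi
              exact hi.2
            exact Metric.ne_of_mem_sphere hy hρ.ne' hy'
        have hcard := Finset.card_lt_card hss
        calc ∑ j with T j y = 0, Real.exp (-(ε * ‖y - m j‖ ^ 2))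
            ≤ ∑ j with T j y = 0, (1 : ℝ) := Finset.sum_le_sum fun j _ =>
              Real.exp_le_one_iff.2 (by have := mul_nonneg hε.le (sq_nonneg ‖y - m j‖); linarith)
          _ ≤ (S.1.card : ℝ) - 1 := by
              rw [Finset.sum_const, nsmul_one, le_sub_iff_add_le]
              exact_mod_cast hcard
          _ < _ := h2
          _ = ∑ j with T j (q (Sum.inr S)) = 0, Real.exp (-(ε * ‖q (Sum.inr S) - m j‖ ^ 2)) := by
              simp only [hq, Sum.elim_inr, hZp]
    obtain ⟨ε, h2, h3⟩ := ((eventually_all.2 h1).and self_mem_nhdsWithin).exists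
    exact ⟨ε, h3, h2⟩
  obtain ⟨N, hN0, hN⟩ : ∃ N ≥ 0, ∀ a, ∀ y ∈ Metric.sphere (q a) ρ,
      ∑ i, Real.exp (-(N * T i y + ε * ‖y - m i‖ ^ 2)) <
        ∑ i with T i (q a) = 0, Real.exp (-(ε * ‖q a - m i‖ ^ 2)) := by
    have h1 := fun a => eventually_sum_exp_lt_of_isCompact (isCompact_sphere (q a) ρ) hTc
      (D := fun i y => ε * ‖y - m i‖ ^ 2) (fun i => by fun_prop) hT0 (fun i x => by positivity)
      (hcore a)
    obtain ⟨N, h2, h3⟩ := ((eventually_all.2 h1).and (eventually_ge_atTop (0 : ℝ))).exists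
    exact ⟨N, h3, h2⟩
  have hA : ∀ i, ((2 * N) • M i + (2 * ε) • 1).PosDef := fun i =>
    Matrix.PosDef.posSemidef_add ((hM i).smul (by positivity))
      (Matrix.PosDef.one.smul (by positivity))
  have hcard : Fintype.card (Fin k ⊕ 𝒮) = k + 𝒮.card := by simp
  rw [← hcard]
  refine card_le_maxModeCount_of_peaks hA (c := 2 * ε) (by positivity) (fun i x => ?_) m q hρ
    (fun a b hab => hdisj a b hab) fun a y hy => ?_
  · have h1 := hT0 i (x + m i)
    simp only [hTdef, centredForm, add_sub_cancel_right] at h1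
    rw [Matrix.inner_toEuclideanCLM, Matrix.add_mulVec, Matrix.smul_mulVec, Matrix.smul_mulVec,
      Matrix.one_mulVec, dotProduct_add, dotProduct_smul, dotProduct_smul,
      ← real_inner_self_eq_norm_sq, EuclideanSpace.inner_eq_star_dotProduct]
    simp only [star_trivial, smul_eq_mul]
    nlinarith [mul_nonneg hN0 h1]
  · simp only [bumpSum, bump_toEuclideanCLM_eq]
    refine (hN a y hy).trans_le ?_
    rw [Finset.sum_filter]
    refine Finset.sum_le_sum fun i _ => ?_
    split_ifs with hi
    · simp only [hTdef] at hi
      rw [hi, mul_zero, zero_add]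
    · exact (Real.exp_pos _).le

end Peaks

/-! ### Affine spaces of monic polynomials with a prescribed root -/

section Arrangement

open Polynomial in
/-- The point of `ℝ^d` whose first `r` coordinates are the coefficients of `P` below degree `r`;
the other coordinates vanish. -/
noncomputable def coeffVec (d r : ℕ) (P : ℝ[X]) : EuclideanSpace ℝ (Fin d) :=
  WithLp.toLp 2 fun j => if (j : ℕ) < r then P.coeff j else 0

/-- The linear form evaluating at `t` the polynomial of degree less than `r` whose coefficients are
the first `r` coordinates. -/
def evalRow (d r : ℕ) (t : ℝ) : Fin d → ℝ := fun j => if (j : ℕ) < r then t ^ (j : ℕ) else 0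

/-- The matrix of the quadratic form `(evalRow d r t · v)² + ∑ j ≥ r, v j ^ 2`. -/
def evalMatrix (d r : ℕ) (t : ℝ) : Matrix (Fin d) (Fin d) ℝ :=
  Matrix.vecMulVec (evalRow d r t) (evalRow d r t) +
    Matrix.diagonal fun j : Fin d => if (j : ℕ) < r then 0 else 1

lemma posSemidef_evalMatrix (d r : ℕ) (t : ℝ) : (evalMatrix d r t).PosSemidef := by
  refine Matrix.PosSemidef.add ?_ (Matrix.PosSemidef.diagonal fun j : Fin d => ?_)
  · simpa using Matrix.posSemidef_vecMulVec_self_star (evalRow d r t)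
  · simp only [Pi.zero_apply]
    split_ifs <;> norm_num

lemma centredForm_evalMatrix (d r : ℕ) (t : ℝ) (m x : EuclideanSpace ℝ (Fin d)) :
    centredForm (evalMatrix d r t) m x =
      (evalRow d r t ⬝ᵥ (x - m).ofLp) ^ 2 +
        ∑ j : Fin d, if (j : ℕ) < r then 0 else ((x - m) j) ^ 2 := by
  rw [centredForm, evalMatrix, Matrix.add_mulVec, dotProduct_add, Matrix.vecMulVec_mulVec]
  congr 1
  · simp only [dotProduct_smul, op_smul_eq_smul, smul_eq_mul]
    rw [dotProduct_comm (x - m).ofLp, sq]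
  · simp only [dotProduct, Matrix.mulVec_diagonal]
    refine Finset.sum_congr rfl fun j _ => ?_
    split_ifs
    · ring
    · ring

open Polynomial

lemma evalRow_dotProduct_coeffVec {d r : ℕ} (hr : r ≤ d) {P : ℝ[X]} (hP : P.Monic)
    (hdeg : P.natDegree = r) (t : ℝ) :
    evalRow d r t ⬝ᵥ (coeffVec d r P).ofLp = P.eval t - t ^ r := by
  have h1 : P.eval t = t ^ r + ∑ j ∈ Finset.range r, P.coeff j * t ^ j := by
    conv_lhs => rw [hP.as_sum, hdeg]
    simp [eval_finsetSum]
  have h2 : evalRow d r t ⬝ᵥ (coeffVec d r P).ofLp =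
      ∑ j ∈ Finset.range d, if j < r then P.coeff j * t ^ j else 0 := by
    rw [← Fin.sum_univ_eq_sum_range (fun j => if j < r then P.coeff j * t ^ j else 0) d]
    refine Finset.sum_congr rfl fun j _ => ?_
    simp only [evalRow, coeffVec]
    split_ifs
    · ring
    · ring
  rw [h1, h2, ← Finset.sum_filter, add_sub_cancel_left]
  refine Finset.sum_congr ?_ fun _ _ => rfl
  ext j
  simp only [Finset.mem_filter, Finset.mem_range]
  omega

/-- The zero set of the form centred at a polynomial `Q` with root `t`: the affine space of monic
polynomials of degree `r` that have `t` as a root. -/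
lemma centredForm_evalMatrix_eq_zero_iff {d r : ℕ} (hr : r ≤ d) {Q : ℝ[X]} (hQ : Q.Monic)
    (hdeg : Q.natDegree = r) {t : ℝ} (ht : Q.eval t = 0) (x : EuclideanSpace ℝ (Fin d)) :
    centredForm (evalMatrix d r t) (coeffVec d r Q) x = 0 ↔
      evalRow d r t ⬝ᵥ x.ofLp = - t ^ r ∧ ∀ j : Fin d, r ≤ j → x j = 0 := by
  have hnn : ∀ j : Fin d, 0 ≤ if (j : ℕ) < r then 0 else ((x - coeffVec d r Q) j) ^ 2 := by
    intro j
    split_ifs <;> positivity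
  rw [centredForm_evalMatrix, add_eq_zero_iff_of_nonneg (sq_nonneg _)
    (Finset.sum_nonneg fun j _ => hnn j), Finset.sum_eq_zero_iff_of_nonneg fun j _ => hnn j]
  refine and_congr ?_ ?_
  · rw [WithLp.ofLp_sub, dotProduct_sub, evalRow_dotProduct_coeffVec hr hQ hdeg, ht, sq_eq_zero_iff,
      zero_sub, sub_eq_zero]
  · refine ⟨fun h j hj => ?_, fun h j _ => ?_⟩
    · simpa [coeffVec, not_lt.2 hj] using h j (Finset.mem_univ j)
    · split_ifs with hj
      · rfl
      · simp [coeffVec, hj, h j (not_lt.1 hj)]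

lemma centredForm_coeffVec_eq_zero_iff {d r : ℕ} (hr : r ≤ d) {P Q : ℝ[X]} (hP : P.Monic)
    (hPdeg : P.natDegree = r) (hQ : Q.Monic) (hQdeg : Q.natDegree = r) {t : ℝ}
    (ht : Q.eval t = 0) :
    centredForm (evalMatrix d r t) (coeffVec d r Q) (coeffVec d r P) = 0 ↔ P.eval t = 0 := by
  rw [centredForm_evalMatrix_eq_zero_iff hr hQ hQdeg ht, evalRow_dotProduct_coeffVec hr hP hPdeg]
  constructor
  · rintro ⟨h, -⟩
    linarith
  · intro h
    refine ⟨by rw [h, zero_sub], fun j hj => ?_⟩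
    simp [coeffVec, not_lt.2 hj]

/-- A polynomial of degree less than `r` is determined by its values at `r` points. -/
lemma eq_of_evalRow_eq {d r : ℕ} {S : Finset ℝ} (hS : S.card = r)
    {x y : EuclideanSpace ℝ (Fin d)} (hx : ∀ j : Fin d, r ≤ j → x j = 0)
    (hy : ∀ j : Fin d, r ≤ j → y j = 0)
    (h : ∀ t ∈ S, evalRow d r t ⬝ᵥ x.ofLp = evalRow d r t ⬝ᵥ y.ofLp) : x = y := by
  set D : ℝ[X] := ∑ j : Fin d, C (x j - y j) * X ^ (j : ℕ) with hD
  have hcoeff : ∀ j : Fin d, D.coeff j = x j - y j := by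
    intro j
    simp only [hD, finsetSum_coeff, coeff_C_mul_X_pow, Fin.val_inj, Finset.sum_ite_eq,
      Finset.mem_univ, if_true]
  have hdeg : D.degree < S.card := by
    rw [hS, degree_lt_iff_coeff_zero]
    intro n hn
    rw [hD, finsetSum_coeff]
    refine Finset.sum_eq_zero fun j _ => ?_
    rw [coeff_C_mul_X_pow]
    split_ifs with hj
    · rw [hx j (hj ▸ hn), hy j (hj ▸ hn), sub_zero]
    · rfl
  have hzero : D = 0 := by
    refine eq_zero_of_degree_lt_of_eval_finset_eq_zero S hdeg fun t ht => ?_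
    rw [← sub_eq_zero.2 (h t ht), ← dotProduct_sub, hD, eval_finsetSum]
    refine Finset.sum_congr rfl fun j _ => ?_
    simp only [eval_mul, eval_C, eval_pow, eval_X, evalRow, Pi.sub_apply]
    split_ifs with hj
    · ring
    · rw [hx j (not_lt.1 hj), hy j (not_lt.1 hj)]
      ring
  ext j
  have := hcoeff j
  rw [hzero, coeff_zero] at this
  linarith

end Arrangement

/-! ### The lower bound -/

open Polynomial in
/-- `m(d,k) ≥ k + C(k,r)`: points of `ℝ^d` whose coordinates from `r` on vanish encode monic
polynomials of degree `r`. The `i`-th Gaussian concentrates on those vanishing at `i` and is centred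
at `(X - i)^r`; the common zeros for `r` indices `S` are the products `∏ i ∈ S, (X - i)`. -/
theorem add_choose_le_maxModeCount {d k r : ℕ} (hr : 2 ≤ r) (hrd : r ≤ d) (hrk : r ≤ k) :
    ((k + k.choose r : ℕ) : ℕ∞) ≤ maxModeCount d k := by
  have : NeZero k := ⟨by omega⟩
  have hcast : Function.Injective fun i : Fin k => ((i : ℕ) : ℝ) := fun i j h =>
    Fin.ext (Nat.cast_injective h)
  set Q : Fin k → ℝ[X] := fun i => (X - C ((i : ℕ) : ℝ)) ^ r
  set P : Finset (Fin k) → ℝ[X] := fun S => ∏ i ∈ S, (X - C ((i : ℕ) : ℝ))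
  have hQ : ∀ i, (Q i).Monic := fun i => (monic_X_sub_C _).pow r
  have hQdeg : ∀ i, (Q i).natDegree = r := fun i => by
    rw [natDegree_pow, natDegree_X_sub_C, mul_one]
  have hQeval : ∀ i, (Q i).eval ((i : ℕ) : ℝ) = 0 := fun i => by
    simp [Q, show r ≠ 0 by omega]
  have hP : ∀ S, (P S).Monic := fun S => monic_prod_of_monic _ _ fun i _ => monic_X_sub_C _
  have hPdeg : ∀ S : Finset (Fin k), S.card = r → (P S).natDegree = r := fun S hS => by
    rw [natDegree_prod_of_monic _ (fun i : Fin k => X - C ((i : ℕ) : ℝ)) fun i _ =>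
      monic_X_sub_C _]
    simp only [natDegree_X_sub_C, Finset.sum_const, hS, smul_eq_mul, mul_one]
  have hPeval : ∀ (S : Finset (Fin k)) (i : Fin k),
      (P S).eval ((i : ℕ) : ℝ) = 0 ↔ i ∈ S := fun S i => by
    simp [P, eval_prod, Finset.prod_eq_zero_iff, sub_eq_zero, Fin.val_inj]
  have hmem : ∀ S ∈ Finset.powersetCard r (Finset.univ : Finset (Fin k)), S.card = r :=
    fun S hS => (Finset.mem_powersetCard.1 hS).2
  have hcard : (Finset.powersetCard r (Finset.univ : Finset (Fin k))).card = k.choose r := by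
    simp
  rw [← hcard]
  refine card_le_maxModeCount_of_arrangement
    (M := fun i => evalMatrix d r ((i : ℕ) : ℝ)) (fun i => posSemidef_evalMatrix _ _ _)
    (m := fun i => coeffVec d r (Q i)) (fun i j => ?_) _ (p := fun S => coeffVec d r (P S))
    (fun S hS => (hmem S hS).symm ▸ hr) (fun S hS i => ?_) (fun S hS y hy => ?_)
  · rw [centredForm_coeffVec_eq_zero_iff hrd (hQ j) (hQdeg j) (hQ i) (hQdeg i) (hQeval i)]
    simp [Q, show r ≠ 0 by omega, sub_eq_zero, Fin.val_inj]
  · rw [centredForm_coeffVec_eq_zero_iff hrd (hP S) (hPdeg S (hmem S hS)) (hQ i) (hQdeg i)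
      (hQeval i), hPeval]
  · have hS0 : S.Nonempty := Finset.card_pos.1 (by have := hmem S hS; omega)
    obtain ⟨i₀, hi₀⟩ := hS0
    have hy' := fun i (hi : i ∈ S) =>
      (centredForm_evalMatrix_eq_zero_iff hrd (hQ i) (hQdeg i) (hQeval i) y).1 (hy i hi)
    refine eq_of_evalRow_eq (S := S.image fun i : Fin k => ((i : ℕ) : ℝ))
      ((Finset.card_image_of_injective S hcast).trans (hmem S hS)) (hy' i₀ hi₀).2
      (fun j hj => by simp [coeffVec, not_lt.2 hj]) fun t ht => ?_
    obtain ⟨i, hi, rfl⟩ := Finset.mem_image.1 ht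
    rw [(hy' i hi).1, evalRow_dotProduct_coeffVec hrd (hP S) (hPdeg S (hmem S hS)),
      (hPeval S i).2 hi, zero_sub]

theorem mainTheorem8 :
    (∀ d k : ℕ, 2 ≤ d → 2 ≤ k →
      ((k + (Finset.Icc 2 (min d k)).sup (fun r => Nat.choose k r) : ℕ) : ℕ∞)
        ≤ maxModeCount d k) ∧
    (∀ d k : ℕ, 4 ≤ k → k / 2 ≤ d →
      ((k + Nat.choose k (k / 2) : ℕ) : ℕ∞) ≤ maxModeCount d k) := by
  refine ⟨fun d k hd hk => ?_, fun d k hk hd =>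
    add_choose_le_maxModeCount (by omega) hd (by omega)⟩
  obtain ⟨r, hr, hsup⟩ := Finset.exists_mem_eq_sup (Finset.Icc 2 (min d k))
    (Finset.nonempty_Icc.2 (le_min hd hk)) fun r => Nat.choose k r
  rw [Finset.mem_Icc, le_min_iff] at hr
  rw [hsup]
  exact add_choose_le_maxModeCount hr.1 hr.2.1 hr.2.2
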